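/- Throughout, complex Lie algebras are considered up to isomorphism, $\mathfrak h_{\mathbb R}$ denotes the real Lie algebra obtained from a complex Lie algebra $\mathfrak h$ by restricting scalars to $\mathbb R$, and $\overline{\mathfrak h}$ denotes its complex conjugate, that is, the same real Lie algebra $\mathfrak h_{\mathbb R}$ in which $z \in \mathbb C$ acts as $\overline z$ acts on $\mathfrak h$. A Lie algebra is called indecomposable if it is not the direct sum of two proper ideals. **Theorem.** Let $\mathfrak g$ be a finite-dimensional complex Lie algebra that is the direct sum of indecomposable ideals $\mathfrak g_{ij}$, $1 \le i \le l$, $1 \le j \le k_i$, where $k_i \ge 1$ for all $i$. Assume that 1. for all $i$ and $1 \le j \le k_i$, either $\mathfrak g_{i1} \cong \mathfrak g_{ij}$ or $\mathfrak g_{i1} \cong \overline{\mathfrak g_{ij}}$; 2. if $\mathfrak g_{i1} \cong \mathfrak g_{i'1}$ or $\mathfrak g_{i1} \cong \overline{\mathfrak g_{i'1}}$, then $i = i'$; 3. $0 \le l_0 \le l$ is such that $\mathfrak g_{i1} \not\cong \overline{\mathfrak g_{i1}}$ if and only if $i \le l_0$. Then there are, up to isomorphism, exactly $$\prod_{i=1}^{l_0}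 (k_i + 1)$$ complex Lie algebras $\mathfrak h$ such that $\mathfrak h_{\mathbb R} \cong \mathfrak g_{\mathbb R}$ (for $l_0 = 0$ the product is $1$). -/

import Mathlib

universe u

/-- A Lie algebra is indecomposable if it is not the direct sum of two proper ideals. -/
def LieAlgebra.IsIndecomposable (R L : Type*) [CommRing R] [LieRing L] [LieAlgebra R L] : Prop :=
  ¬ ∃ I J : LieIdeal R L, I ≠ ⊤ ∧ J ≠ ⊤ ∧ IsCompl I J

/-- The complex conjugate of a complex Lie algebra `L`: the same additive group with the same
bracket, on which a scalar `z` acts as its complex conjugate acted on `L`. -/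
def ConjLie (L : Type*) : Type _ := L

namespace ConjLie

variable {L : Type*} [LieRing L]

instance : LieRing (ConjLie L) := inferInstanceAs (LieRing L)

/-- The identity map, as an additive equivalence from `L` to its complex conjugate. -/
def of : L ≃+ ConjLie L := AddEquiv.refl L

@[simp]
theorem of_lie (x y : L) : of ⁅x, y⁆ = ⁅of x, of y⁆ := rfl

theorem of_symm_lie (x y : ConjLie L) : of.symm ⁅x, y⁆ = ⁅of.symm x, of.symm y⁆ := rfl

variable [LieAlgebra ℂ L]

instance : Module ℂ (ConjLie L) := Module.compHom L (starRingEnd ℂ)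

theorem smul_def (z : ℂ) (x : ConjLie L) : z • x = of (starRingEnd ℂ z • of.symm x) := rfl

instance : LieAlgebra ℂ (ConjLie L) where
  lie_smul z x y := lie_smul (starRingEnd ℂ z) (of.symm x) (of.symm y)

/-- The identity map `L → ConjLie L` is conjugate-linear; by `of_lie` it preserves the bracket, so
that `ConjLie L` is the conjugate Lie algebra of `L` for complex conjugation. -/
def ofₛₗ : L ≃ₛₗ[starRingEnd ℂ] ConjLie L where
  __ := of
  map_smul' z x := by
    change of (z • x) = starRingEnd ℂ z • of x
    simp [smul_def]

end ConjLie

/-- Complex Lie algebras (of any dimension), bundled. -/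
structure ComplexLieAlgebra : Type (u + 1) where
  carrier : Type u
  [lieRing : LieRing carrier]
  [lieAlgebra : LieAlgebra ℂ carrier]

namespace ComplexLieAlgebra

attribute [instance] lieRing lieAlgebra

/-- Isomorphism of complex Lie algebras. -/
instance isoSetoid : Setoid ComplexLieAlgebra.{u} where
  r A B := Nonempty (A.carrier ≃ₗ⁅ℂ⁆ B.carrier)
  iseqv := ⟨fun _ => ⟨LieEquiv.refl⟩, fun ⟨e⟩ => ⟨e.symm⟩, fun ⟨e⟩ ⟨f⟩ => ⟨e.trans f⟩⟩

/-- The isomorphism classes of those complex Lie algebras `H` whose underlying real Lie algebra is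
isomorphic to the underlying real Lie algebra of `G`. -/
def classesWithSameReal (G : Type u) [LieRing G] [LieAlgebra ℂ G] :
    Set (Quotient isoSetoid.{u}) :=
  {c | ∃ H : ComplexLieAlgebra.{u}, ⟦H⟧ = c ∧
    Nonempty (RestrictScalars ℝ ℂ H.carrier ≃ₗ⁅ℝ⁆ RestrictScalars ℝ ℂ G)}

end ComplexLieAlgebra

/-! Isomorphism classes of complex Lie algebras form a commutative monoid under direct product, on
which conjugation acts as an involution `conj`. The theorem follows from two facts about this
monoid.

First, the classes with the same underlying real Lie algebra as `G` are exactly the `a * conj b`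
with `cls G = a * b` (`mem_classesWithSameReal_iff`). Given a real isomorphism `d : G → H`, pull
multiplication by `I` on `H` back to a second complex structure `J` on `G`. Both `I` and `J` can be
moved in and out of either slot of a bracket, so they commute on brackets, and there `J = I` or `J =
-I` on two complementary pieces. Hence `G` is the sum of two ideals `d.part 1` and `d.part (-1)`
that commute and meet in the centre. Trimming their central overlap gives `G = A ⊕ B ⊕ W` with `W`
central. On `A` and `B` the map `d` is replaced by its linear and conjugate-linear component, which
agrees with `d` where it matters; `W` is matched with a central ideal of `H` by dimension. This
yields `H ≅ A × W × conj B` (`exists_cls_eq_mul_conj`).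

Second, Krull–Schmidt holds. By Fitting's lemma a finite-dimensional indecomposable factor can be
exchanged into one side of any product decomposition (`exists_exchange`), which gives cancellation,
splitting of factorizations and uniqueness (`multiset_eq_of_prod_eq`).

So `a * conj b` arises by conjugating some of the indecomposable factors of `G`. Only the number of
conjugated factors in each non-self-conjugate block matters, and it can be any of `0, ..., k i`;
uniqueness shows that different numbers give different classes. -/

namespace LieAlgebra

/-! ### Fitting's lemma and the exchange property -/

section Exchange

variable {K C X Y Z L : Type*} [Field K]
  [LieRing C] [LieAlgebra K C] [LieRing X] [LieAlgebra K X] [LieRing Y] [LieAlgebra K Y]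
  [LieRing Z] [LieAlgebra K Z] [LieRing L] [LieAlgebra K L]

/-- The Lie algebra homomorphism `(x, y) ↦ f x + g y` defined by two homomorphisms `f` and `g`
with commuting images. -/
def coprodHom (f : X →ₗ⁅K⁆ L) (g : Y →ₗ⁅K⁆ L) (h : ∀ x y, ⁅f x, g y⁆ = 0) : X × Y →ₗ⁅K⁆ L where
  toLinearMap := LinearMap.coprod (f : X →ₗ[K] L) (g : Y →ₗ[K] L)
  map_lie' := by
    rintro ⟨a, b⟩ ⟨c, d⟩
    have h' : ⁅g b, f c⁆ = 0 := by rw [← lie_skew, h, neg_zero]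
    simp [h, h']

@[simp]
theorem coprodHom_apply (f : X →ₗ⁅K⁆ L) (g : Y →ₗ⁅K⁆ L) (h : ∀ x y, ⁅f x, g y⁆ = 0) (p : X × Y) :
    coprodHom f g h p = f p.1 + g p.2 := rfl

/-- Fitting's lemma for endomorphisms of the adjoint representation. -/
theorem isNilpotent_or_bijective [FiniteDimensional K C] (hC : IsIndecomposable K C)
    (f : Module.End K C) (hf : ∀ x y : C, f ⁅x, y⁆ = ⁅x, f y⁆) :
    IsNilpotent f ∨ Function.Bijective f := by
  have hpow : ∀ (n : ℕ) (x y : C), (f ^ n) ⁅x, y⁆ = ⁅x, (f ^ n) y⁆ := by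
    intro n
    induction n with
    | zero => simp
    | succ n ih => intro x y; rw [pow_succ', Module.End.mul_apply, ih, hf]; rfl
  -- The bound `1 ≤ n` lets one factor `f` be split off from `f ^ n`, so that surjectivity passes
  -- from the power to `f`.
  obtain ⟨n, hn⟩ := (f.eventually_isCompl_ker_pow_range_pow.and
    (Filter.eventually_ge_atTop 1)).exists
  let I : LieIdeal K C :=
    { LinearMap.ker (f ^ n) with
      lie_mem := fun {x m} hm => by
        change (f ^ n) ⁅x, m⁆ = 0
        rw [hpow, show (f ^ n) m = 0 from hm, lie_zero] }
  let J : LieIdeal K C :=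
    { LinearMap.range (f ^ n) with
      lie_mem := fun {x m} hm => by
        obtain ⟨y, rfl⟩ := hm
        exact ⟨⁅x, y⁆, hpow n x y⟩ }
  have hIJ : IsCompl I J := LieSubmodule.isCompl_toSubmodule.mp hn.1
  by_cases hI : I = ⊤
  · left
    refine ⟨n, LinearMap.ker_eq_top.mp ?_⟩
    exact (LieSubmodule.toSubmodule_eq_top (N := I)).mpr hI
  · have hJ : J = ⊤ := by
      by_contra hJ
      exact hC ⟨I, J, hI, hJ, hIJ⟩
    right
    have hr : LinearMap.range (f ^ n) = ⊤ := (LieSubmodule.toSubmodule_eq_top (N := J)).mpr hJ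
    have hs : Function.Surjective f := by
      intro x
      obtain ⟨y, hy⟩ := LinearMap.range_eq_top.mp hr x
      obtain ⟨m, rfl⟩ := Nat.exists_eq_add_of_le' hn.2
      exact ⟨(f ^ m) y, by rw [← hy, pow_succ', Module.End.mul_apply]⟩
    exact ⟨LinearMap.injective_iff_surjective.mpr hs, hs⟩

/-- Locality of the endomorphism ring of the adjoint representation: if `f` is nilpotent, then `g =
1 - f` is a unit. -/
theorem bijective_or_bijective_of_add_eq_id [FiniteDimensional K C] (hC : IsIndecomposable K C)
    (f g : Module.End K C) (hf : ∀ x y : C, f ⁅x, y⁆ = ⁅x, f y⁆) (hfg : f + g = 1) :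
    Function.Bijective f ∨ Function.Bijective g := by
  rcases isNilpotent_or_bijective hC f hf with h | h
  · right
    rw [eq_sub_of_add_eq' hfg]
    exact (Module.End.isUnit_iff _).mp h.isUnit_one_sub
  · exact Or.inl h

/-- If the endomorphism `C → C × X ≃ Y × Z → Y → Y × Z ≃ C × X → C` is bijective, then `C` can be
split off from `Y`, and the remaining factors of both decompositions are isomorphic. -/
theorem exists_exchange_of_bijective (φ : (C × X) ≃ₗ⁅K⁆ (Y × Z))
    (hφ : Function.Bijective fun c : C => (φ.symm ((φ (c, 0)).1, 0)).1) :
    ∃ N : LieIdeal K Y, Nonempty ((C × N) ≃ₗ⁅K⁆ Y) ∧ Nonempty ((N × Z) ≃ₗ⁅K⁆ X) := by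
  let p : C →ₗ⁅K⁆ Y := (LieHom.fst K Y Z).comp (φ.toLieHom.comp (LieHom.inl K C X))
  let q : Y →ₗ⁅K⁆ C := (LieHom.fst K C X).comp (φ.symm.toLieHom.comp (LieHom.inl K Y Z))
  let r : Y × Z →ₗ⁅K⁆ X := (LieHom.snd K C X).comp φ.symm.toLieHom
  have hp : ∀ c, p c = (φ (c, 0)).1 := fun _ => rfl
  have hφs : ∀ w, φ (φ.symm w) = w := φ.apply_symm_apply
  have hsφ : ∀ w, φ.symm (φ w) = w := φ.symm_apply_apply
  have hb : Function.Bijective fun c : C => q (p c) := hφ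
  have hinj : ∀ c, q (p c) = 0 → c = 0 := fun c hc => hb.1 (by simpa using hc)
  have hcomm : ∀ (c : C) (n : q.ker), ⁅p c, (n : Y)⁆ = 0 := by
    intro c n
    have hn : q (n : Y) = 0 := n.2
    obtain ⟨w, hw⟩ : ∃ w, φ w = ((n : Y), 0) := ⟨_, hφs _⟩
    -- Bracketing with `(c, 0)` lands in `C`, so the bracket is again in the image of `p`. As `q`
    -- kills it and `q ∘ p` is injective, it vanishes.
    have h1 : ⁅p c, (n : Y)⁆ = p ⁅c, w.1⁆ := by
      have := congrArg Prod.fst (LieEquiv.map_lie φ (c, 0) w)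
      rw [hw] at this
      simp only [LieAlgebra.Prod.bracket_apply, zero_lie] at this
      rw [hp, hp, this]
    have h2 : ⁅c, w.1⁆ = 0 := hinj _ (by rw [← h1, LieHom.map_lie, hn, lie_zero])
    rw [h1, h2, map_zero]
  refine ⟨q.ker, ⟨LieEquiv.ofBijective (coprodHom p (LieSubalgebra.incl (q.ker : LieSubalgebra K Y))
    hcomm) ⟨?_, ?_⟩⟩, ⟨LieEquiv.ofBijective
      (r.comp (LieHom.prodMap (LieSubalgebra.incl (q.ker : LieSubalgebra K Y)) LieHom.id))
      ⟨?_, ?_⟩⟩⟩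
  · rw [injective_iff_map_eq_zero]
    rintro ⟨c, n⟩ h
    have hn : q (n : Y) = 0 := n.2
    have h' : p c + (n : Y) = 0 := h
    have hc : c = 0 := hinj c (by
      have := congrArg q h'
      rwa [map_add, hn, add_zero, map_zero] at this)
    subst hc
    have : (n : Y) = 0 := by simpa using h'
    ext
    · rfl
    · exact this
  · intro y
    obtain ⟨c, hc⟩ := hb.2 (q y)
    refine ⟨(c, ⟨y - p c, ?_⟩), ?_⟩
    · change q (y - p c) = 0
      rw [map_sub]
      exact sub_eq_zero.mpr hc.symm
    · change p c + (y - p c) = y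
      abel
  · rw [injective_iff_map_eq_zero]
    rintro ⟨n, z⟩ h
    have hn : q (n : Y) = 0 := n.2
    have h' : (φ.symm ((n : Y), z)).2 = 0 := h
    set c := (φ.symm ((n : Y), z)).1 with hcdef
    have h1 : φ (c, 0) = ((n : Y), z) := by
      rw [← hφs ((n : Y), z)]
      congr 1
      exact Prod.ext hcdef h'.symm
    have hc : c = 0 := hinj c (by rw [hp, h1]; exact hn)
    rw [hc] at h1
    have h2 : ((n : Y), z) = (0 : Y × Z) := by rw [← h1]; exact map_zero φ.toLieHom
    ext
    · exact congrArg Prod.fst h2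
    · exact (Prod.mk.inj h2).2
  · intro x
    -- The preimage of `x` is sought as `φ (c, x)`; this `c` makes its `Y`-component lie in `q.ker`.
    obtain ⟨c, hc⟩ := hb.2 (- q (φ (0, x)).1)
    have h1 : φ (c, x) = φ (c, 0) + φ (0, x) := by
      rw [← map_add]; simp
    refine ⟨(⟨(φ (c, x)).1, ?_⟩, (φ (c, x)).2), ?_⟩
    · change q (φ (c, x)).1 = 0
      rw [h1, Prod.fst_add, map_add, ← hp, show q (p c) = _ from hc, neg_add_cancel]
    · change (φ.symm (φ (c, x))).2 = x
      rw [hsφ]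

/-- The round trips of `C` through `Y` and through `Z` add up to the identity of `C`, so one of them
is bijective and `C` splits off from that factor. -/
theorem exists_exchange [FiniteDimensional K C] (hC : IsIndecomposable K C)
    (φ : (C × X) ≃ₗ⁅K⁆ (Y × Z)) :
    (∃ N : LieIdeal K Y, Nonempty ((C × N) ≃ₗ⁅K⁆ Y) ∧ Nonempty ((N × Z) ≃ₗ⁅K⁆ X)) ∨
    ∃ N : LieIdeal K Z, Nonempty ((C × N) ≃ₗ⁅K⁆ Z) ∧ Nonempty ((N × Y) ≃ₗ⁅K⁆ X) := by
  have hsφ : ∀ w, φ.symm (φ w) = w := φ.symm_apply_apply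
  let f : Module.End K C := LinearMap.fst K C X ∘ₗ φ.symm.toLinearEquiv.toLinearMap ∘ₗ
    LinearMap.inl K Y Z ∘ₗ LinearMap.fst K Y Z ∘ₗ φ.toLinearEquiv.toLinearMap ∘ₗ LinearMap.inl K C X
  let g : Module.End K C := LinearMap.fst K C X ∘ₗ φ.symm.toLinearEquiv.toLinearMap ∘ₗ
    LinearMap.inr K Y Z ∘ₗ LinearMap.snd K Y Z ∘ₗ φ.toLinearEquiv.toLinearMap ∘ₗ LinearMap.inl K C X
  have hf : ∀ c, f c = (φ.symm ((φ (c, 0)).1, 0)).1 := fun _ => rfl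
  have hg : ∀ c, g c = (φ.symm (0, (φ (c, 0)).2)).1 := fun _ => rfl
  have hfg : f + g = 1 := by
    ext c
    rw [LinearMap.add_apply, hf, hg, ← Prod.fst_add, ← map_add]
    simp [hsφ]
  have hfl : ∀ x y : C, f ⁅x, y⁆ = ⁅x, f y⁆ := by
    intro x y
    have h1 : φ (⁅x, y⁆, 0) = ⁅φ (x, 0), φ (y, 0)⁆ := by
      rw [← LieEquiv.map_lie]; simp
    have h2 : (((⁅φ (x, 0), φ (y, 0)⁆ : Y × Z).1, 0) : Y × Z) = ⁅φ (x, 0), ((φ (y, 0)).1, 0)⁆ := by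
      simp
    rw [hf, hf, h1, h2, LieEquiv.map_lie, hsφ]
    simp
  rcases bijective_or_bijective_of_add_eq_id hC f g hfl hfg with h | h
  · exact Or.inl (exists_exchange_of_bijective φ h)
  · right
    let s : (Y × Z) ≃ₗ⁅K⁆ (Z × Y) :=
      { LinearEquiv.prodComm K Y Z with map_lie' := by intros; rfl }
    exact exists_exchange_of_bijective (φ.trans s) h

/-- Complementary ideals decompose a Lie algebra as a product. -/
theorem nonempty_prod_equiv_sup {I J : LieIdeal K L} (h : Disjoint I J) :
    Nonempty ((I × J) ≃ₗ⁅K⁆ (I ⊔ J : LieIdeal K L)) := by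
  have hd : ∀ x ∈ I, x ∈ J → x = 0 := by
    intro x hI hJ
    have : x ∈ I ⊓ J := ⟨hI, hJ⟩
    rwa [h.eq_bot, LieSubmodule.mem_bot] at this
  let i : I →ₗ⁅K⁆ (I ⊔ J : LieIdeal K L) :=
    { Submodule.inclusion (show I.toSubmodule ≤ (I ⊔ J).toSubmodule from
        (le_sup_left : I ≤ I ⊔ J)) with map_lie' := by intros; rfl }
  let j : J →ₗ⁅K⁆ (I ⊔ J : LieIdeal K L) :=
    { Submodule.inclusion (show J.toSubmodule ≤ (I ⊔ J).toSubmodule from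
        (le_sup_right : J ≤ I ⊔ J)) with map_lie' := by intros; rfl }
  have hij : ∀ x y, ⁅i x, j y⁆ = 0 := fun x y => Subtype.ext (hd ⁅(x : L), (y : L)⁆
    (lie_mem_left K L I _ _ x.2) (J.lie_mem y.2))
  refine ⟨LieEquiv.ofBijective (coprodHom i j hij) ⟨?_, ?_⟩⟩
  · rw [injective_iff_map_eq_zero]
    rintro ⟨x, y⟩ h
    have h' : (x : L) + y = 0 := congrArg Subtype.val h
    have hx : (x : L) = 0 := hd _ x.2 (by rw [eq_neg_of_add_eq_zero_left h']; exact neg_mem y.2)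
    have hy : (y : L) = 0 := by simpa [hx] using h'
    ext
    · exact hx
    · exact hy
  · rintro ⟨z, hz⟩
    obtain ⟨x, hx, y, hy, rfl⟩ := (LieSubmodule.mem_sup _ _ _).mp hz
    exact ⟨(⟨x, hx⟩, ⟨y, hy⟩), rfl⟩

end Exchange

end LieAlgebra

/-! ### The commutative monoid of isomorphism classes -/

namespace ComplexLieAlgebra

/-- The isomorphism class of a complex Lie algebra. -/
def cls (L : Type u) [LieRing L] [LieAlgebra ℂ L] : Quotient isoSetoid.{u} := ⟦⟨L⟩⟧

section

variable {L M N : Type u} [LieRing L] [LieAlgebra ℂ L] [LieRing M] [LieAlgebra ℂ M]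
  [LieRing N] [LieAlgebra ℂ N]

theorem cls_eq_cls_iff : cls L = cls M ↔ Nonempty (L ≃ₗ⁅ℂ⁆ M) := Quotient.eq

theorem exists_eq_cls (c : Quotient isoSetoid.{u}) :
    ∃ A : ComplexLieAlgebra.{u}, c = cls A.carrier := by
  induction c using Quotient.inductionOn with
  | h A => exact ⟨A, rfl⟩

instance : Mul (Quotient isoSetoid.{u}) where
  mul := Quotient.map₂ (fun A B => ⟨A.carrier × B.carrier⟩) (by
    rintro A A' ⟨e⟩ B B' ⟨f⟩
    exact ⟨{ e.toLinearEquiv.prodCongr f.toLinearEquiv with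
      map_lie' := fun {x y} => Prod.ext (e.map_lie x.1 y.1) (f.map_lie x.2 y.2) }⟩)

theorem cls_mul : cls L * cls M = cls (L × M) := rfl

instance : LieRing PUnit.{u + 1} where
  bracket _ _ := 0
  add_lie _ _ _ := rfl
  lie_add _ _ _ := rfl
  lie_self _ := rfl
  leibniz_lie _ _ _ := rfl

instance : LieAlgebra ℂ PUnit.{u + 1} where
  lie_smul _ _ _ := rfl

/-- The zero Lie algebra. -/
def zeroLieAlgebra : ComplexLieAlgebra.{u} := ⟨PUnit⟩

instance : Subsingleton zeroLieAlgebra.{u}.carrier := inferInstanceAs (Subsingleton PUnit)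

instance : One (Quotient isoSetoid.{u}) := ⟨⟦zeroLieAlgebra⟧⟩

theorem cls_eq_one_iff : cls L = 1 ↔ Subsingleton L := by
  constructor
  · intro h
    obtain ⟨e⟩ := cls_eq_cls_iff.mp (h : cls L = cls zeroLieAlgebra.carrier)
    exact e.injective.subsingleton
  · intro h
    refine cls_eq_cls_iff.mpr (⟨?_⟩ : Nonempty (L ≃ₗ⁅ℂ⁆ zeroLieAlgebra.{u}.carrier))
    exact { (0 : L ≃ₗ[ℂ] zeroLieAlgebra.{u}.carrier) with
      map_lie' := fun {_ _} => Subsingleton.elim _ _ }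

instance : CommMonoid (Quotient isoSetoid.{u}) where
  mul_assoc a b c := by
    obtain ⟨⟨A⟩, rfl⟩ := exists_eq_cls a
    obtain ⟨⟨B⟩, rfl⟩ := exists_eq_cls b
    obtain ⟨⟨C⟩, rfl⟩ := exists_eq_cls c
    exact cls_eq_cls_iff.mpr ⟨{ LinearEquiv.prodAssoc ℂ A B C with map_lie' := rfl }⟩
  mul_comm a b := by
    obtain ⟨⟨A⟩, rfl⟩ := exists_eq_cls a
    obtain ⟨⟨B⟩, rfl⟩ := exists_eq_cls b
    exact cls_eq_cls_iff.mpr ⟨{ LinearEquiv.prodComm ℂ A B with map_lie' := rfl }⟩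
  one_mul a := by
    obtain ⟨⟨A⟩, rfl⟩ := exists_eq_cls a
    refine cls_eq_cls_iff.mpr (⟨LieEquiv.ofBijective (LieHom.snd ℂ zeroLieAlgebra.carrier A)
      ⟨fun x y h => Prod.ext (Subsingleton.elim _ _) h, LieHom.snd_surjective⟩⟩ :
        Nonempty ((zeroLieAlgebra.{u}.carrier × A) ≃ₗ⁅ℂ⁆ A))
  mul_one a := by
    obtain ⟨⟨A⟩, rfl⟩ := exists_eq_cls a
    refine cls_eq_cls_iff.mpr (⟨LieEquiv.ofBijective (LieHom.fst ℂ A zeroLieAlgebra.carrier)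
      ⟨fun x y h => Prod.ext h (Subsingleton.elim _ _), LieHom.fst_surjective⟩⟩ :
        Nonempty ((A × zeroLieAlgebra.{u}.carrier) ≃ₗ⁅ℂ⁆ A))

theorem eq_one_of_mul_eq_one {a b : Quotient isoSetoid.{u}} (h : a * b = 1) : a = 1 := by
  obtain ⟨⟨A⟩, rfl⟩ := exists_eq_cls a
  obtain ⟨⟨B⟩, rfl⟩ := exists_eq_cls b
  rw [cls_mul, cls_eq_one_iff] at h
  rw [cls_eq_one_iff]
  exact (Prod.mk_left_injective (0 : B)).subsingleton

end

/-! ### Conjugation as an involution of the monoid -/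

section Conj

variable {L M : Type u} [LieRing L] [LieAlgebra ℂ L] [LieRing M] [LieAlgebra ℂ M]

/-- An isomorphism is also an isomorphism of the complex conjugates. -/
def conjEquiv (e : L ≃ₗ⁅ℂ⁆ M) : ConjLie L ≃ₗ⁅ℂ⁆ ConjLie M where
  toFun x := ConjLie.of (e (ConjLie.of.symm x))
  invFun x := ConjLie.of (e.symm (ConjLie.of.symm x))
  map_add' x y := by simp
  map_smul' z x := by simp [ConjLie.smul_def]
  map_lie' {x y} := e.map_lie _ _
  left_inv x := by simp
  right_inv x := by simp

/-- Complex conjugation of isomorphism classes of complex Lie algebras. -/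
def conj : Quotient isoSetoid.{u} →* Quotient isoSetoid.{u} where
  toFun := Quotient.map (fun A => ⟨ConjLie A.carrier⟩) fun A B ⟨e⟩ =>
    ⟨conjEquiv (L := A.carrier) (M := B.carrier) e⟩
  map_one' := cls_eq_one_iff.mpr
    (inferInstanceAs (Subsingleton zeroLieAlgebra.{u}.carrier))
  map_mul' a b := by
    obtain ⟨⟨A⟩, rfl⟩ := exists_eq_cls a
    obtain ⟨⟨B⟩, rfl⟩ := exists_eq_cls b
    exact cls_eq_cls_iff.mpr (⟨{
      toFun := fun x => x
      invFun := fun x => x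
      map_add' := fun _ _ => rfl
      map_smul' := fun _ _ => rfl
      map_lie' := rfl
      left_inv := fun _ => rfl
      right_inv := fun _ => rfl }⟩ : Nonempty (ConjLie (A × B) ≃ₗ⁅ℂ⁆ (ConjLie A × ConjLie B)))

theorem conj_cls : conj (cls L) = cls (ConjLie L) := rfl

theorem conj_conj (c : Quotient isoSetoid.{u}) : conj (conj c) = c := by
  obtain ⟨⟨A⟩, rfl⟩ := exists_eq_cls c
  refine cls_eq_cls_iff.mpr (⟨{
      toFun := fun x => ConjLie.of.symm (ConjLie.of.symm x)
      invFun := fun x => ConjLie.of (ConjLie.of x)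
      map_add' := fun _ _ => rfl
      map_smul' := fun z x => ?_
      map_lie' := rfl
      left_inv := fun _ => rfl
      right_inv := fun _ => rfl }⟩ : Nonempty (ConjLie (ConjLie A) ≃ₗ⁅ℂ⁆ A))
  simp [ConjLie.smul_def]

instance [FiniteDimensional ℂ L] : FiniteDimensional ℂ (ConjLie L) :=
  Module.Finite.of_surjective (ConjLie.ofₛₗ (L := L)).toLinearMap ConjLie.ofₛₗ.surjective

/-- A Lie algebra and its complex conjugate have the same ideals. -/
def conjIdeal : LieIdeal ℂ (ConjLie L) ≃o LieIdeal ℂ L where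
  toFun I :=
    { carrier := {x | ConjLie.of x ∈ I}
      add_mem' := fun {x y} hx hy => I.add_mem hx hy
      zero_mem' := I.zero_mem
      smul_mem' := fun z x hx => by
        have hmem : starRingEnd ℂ z • ConjLie.of x ∈ I := I.smul_mem _ hx
        have h : starRingEnd ℂ z • ConjLie.of x = ConjLie.of (z • x) := by
          simp [ConjLie.smul_def]
        rwa [h] at hmem
      lie_mem := fun {x m} hm => I.lie_mem hm }
  invFun I :=
    { carrier := {x | ConjLie.of.symm x ∈ I}
      add_mem' := fun {x y} hx hy => I.add_mem hx hy
      zero_mem' := I.zero_mem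
      smul_mem' := fun z x hx => I.smul_mem (starRingEnd ℂ z) hx
      lie_mem := fun {x m} hm => I.lie_mem hm }
  left_inv _ := rfl
  right_inv _ := rfl
  map_rel_iff' := Iff.rfl

theorem isIndecomposable_conjLie (h : LieAlgebra.IsIndecomposable ℂ L) :
    LieAlgebra.IsIndecomposable ℂ (ConjLie L) := by
  rintro ⟨I, J, hI, hJ, hIJ⟩
  exact h ⟨conjIdeal I, conjIdeal J, by simpa using hI, by simpa using hJ,
    conjIdeal.isCompl hIJ⟩

end Conj

/-! ### Krull–Schmidt for isomorphism classes -/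

section Indec

/-- The classes of finite-dimensional indecomposable Lie algebras. The zero Lie algebra is
included. -/
def IsIndec (c : Quotient isoSetoid.{u}) : Prop :=
  ∃ A : ComplexLieAlgebra.{u}, c = cls A.carrier ∧ FiniteDimensional ℂ A.carrier ∧
    LieAlgebra.IsIndecomposable ℂ A.carrier

theorem isIndec_cls (L : Type u) [LieRing L] [LieAlgebra ℂ L] [FiniteDimensional ℂ L]
    (h : LieAlgebra.IsIndecomposable ℂ L) : IsIndec (cls L) := ⟨⟨L⟩, rfl, inferInstance, h⟩

variable {a b c x y z : Quotient isoSetoid.{u}}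

theorem IsIndec.conj (h : IsIndec c) : IsIndec (conj c) := by
  obtain ⟨⟨A⟩, rfl, hA, h⟩ := h
  exact isIndec_cls (ConjLie A) (isIndecomposable_conjLie h)

theorem IsIndec.exchange (hc : IsIndec c) (h : c * x = y * z) :
    (∃ w, y = c * w ∧ x = w * z) ∨ ∃ w, z = c * w ∧ x = w * y := by
  obtain ⟨⟨C⟩, rfl, hC, hi⟩ := hc
  obtain ⟨⟨X⟩, rfl⟩ := exists_eq_cls x
  obtain ⟨⟨Y⟩, rfl⟩ := exists_eq_cls y
  obtain ⟨⟨Z⟩, rfl⟩ := exists_eq_cls z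
  obtain ⟨φ⟩ := cls_eq_cls_iff.mp h
  rcases LieAlgebra.exists_exchange hi φ with ⟨N, h1, h2⟩ | ⟨N, h1, h2⟩
  · exact Or.inl ⟨cls N, (cls_eq_cls_iff.mpr h1).symm, (cls_eq_cls_iff.mpr h2).symm⟩
  · exact Or.inr ⟨cls N, (cls_eq_cls_iff.mpr h1).symm, (cls_eq_cls_iff.mpr h2).symm⟩

/-- The kernels of the two projections are complementary ideals, and each is proper when the
corresponding factor is nonzero. -/
theorem IsIndec.eq_one_or_eq_one (hc : IsIndec c) (h : c = a * b) : a = 1 ∨ b = 1 := by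
  obtain ⟨⟨C⟩, rfl, hC, hi⟩ := hc
  obtain ⟨⟨A⟩, rfl⟩ := exists_eq_cls a
  obtain ⟨⟨B⟩, rfl⟩ := exists_eq_cls b
  obtain ⟨φ⟩ := cls_eq_cls_iff.mp h
  let p : C →ₗ⁅ℂ⁆ A := (LieHom.fst ℂ A B).comp φ.toLieHom
  let q : C →ₗ⁅ℂ⁆ B := (LieHom.snd ℂ A B).comp φ.toLieHom
  have hp : Function.Surjective p := (LieHom.fst_surjective (R := ℂ)).comp φ.surjective
  have hq : Function.Surjective q := (LieHom.snd_surjective (R := ℂ)).comp φ.surjective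
  rw [cls_eq_one_iff, cls_eq_one_iff]
  by_contra! hne
  refine hi ⟨p.ker, q.ker, fun h => ?_, fun h => ?_, ?_⟩
  · refine not_subsingleton_iff_nontrivial.mpr hne.1 (subsingleton_of_forall_eq 0 fun x => ?_)
    obtain ⟨y, rfl⟩ := hp x
    exact (LieHom.mem_ker (f := p)).mp (h ▸ LieSubmodule.mem_top y)
  · refine not_subsingleton_iff_nontrivial.mpr hne.2 (subsingleton_of_forall_eq 0 fun x => ?_)
    obtain ⟨y, rfl⟩ := hq x
    exact (LieHom.mem_ker (f := q)).mp (h ▸ LieSubmodule.mem_top y)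
  · constructor
    · rw [disjoint_iff, eq_bot_iff]
      rintro x ⟨h1, h2⟩
      have h1 : (φ x).1 = 0 := h1
      have h2 : (φ x).2 = 0 := h2
      exact φ.injective ((Prod.ext h1 h2 : φ x = 0).trans (map_zero φ).symm)
    · rw [codisjoint_iff, eq_top_iff]
      intro x _
      obtain ⟨y, hy⟩ : ∃ y, φ y = (0, (φ x).2) := φ.surjective (0, (φ x).2)
      obtain ⟨z, hz⟩ : ∃ z, φ z = ((φ x).1, 0) := φ.surjective ((φ x).1, 0)
      refine (LieSubmodule.mem_sup _ _ _).mpr ⟨y, ?_, z, ?_, φ.injective ?_⟩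
      · change (φ y).1 = 0
        rw [hy]
      · change (φ z).2 = 0
        rw [hz]
      · have hyz : φ (y + z) = φ x := by
          rw [map_add, hy, hz]
          simp
        exact hyz

theorem IsIndec.eq_of_eq_mul (hc : IsIndec c) (ha : a ≠ 1) (h : c = a * b) : c = a := by
  rcases hc.eq_one_or_eq_one h with h1 | h1
  · exact absurd h1 ha
  · rw [h, h1, mul_one]

/-- Exchange the left `c` into `c * y`. If it lands in `c`, the remainder is trivial; if it lands in
`y`, then `x` and `y` are both `c` times the same remainder. The other factors may have any
dimension. -/
theorem IsIndec.mul_left_cancel (hc : IsIndec c) (h : c * x = c * y) : x = y := by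
  rcases hc.exchange h with ⟨w, h1, h2⟩ | ⟨w, h1, h2⟩
  · have hw : w = 1 := by
      rcases hc.eq_one_or_eq_one h1 with h3 | h3
      · rwa [h3, one_mul, eq_comm] at h1
      · exact h3
    rw [h2, hw, one_mul]
  · rw [h1, h2, mul_comm]

/-- The factors of a product of two classes distribute the indecomposable factors. -/
theorem exists_split {ι : Type*} [DecidableEq ι] (s : Finset ι) (f : ι → Quotient isoSetoid.{u})
    (hf : ∀ i ∈ s, IsIndec (f i)) (h : ∏ i ∈ s, f i = a * b) :
    ∃ t ⊆ s, a = ∏ i ∈ t, f i ∧ b = ∏ i ∈ s \ t, f i := by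
  induction s using Finset.induction_on generalizing a b with
  | empty =>
    rw [Finset.prod_empty] at h
    exact ⟨∅, subset_rfl, by simpa using eq_one_of_mul_eq_one h.symm,
      by simpa using eq_one_of_mul_eq_one ((mul_comm b a).trans h.symm)⟩
  | insert i s hi ih =>
    have hs : ∀ j ∈ s, IsIndec (f j) := fun j hj => hf j (Finset.mem_insert_of_mem hj)
    rw [Finset.prod_insert hi] at h
    rcases (hf i (Finset.mem_insert_self i s)).exchange h with ⟨w, h1, h2⟩ | ⟨w, h1, h2⟩
    · obtain ⟨t, hts, h3, h4⟩ := ih hs h2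
      refine ⟨insert i t, Finset.insert_subset_insert i hts, ?_, ?_⟩
      · rw [Finset.prod_insert fun h => hi (hts h), h1, h3]
      · rw [h4, Finset.insert_sdiff_insert, Finset.sdiff_insert_of_notMem hi]
    · obtain ⟨t, hts, h3, h4⟩ := ih hs (h2.trans (mul_comm w a))
      refine ⟨t, hts.trans (Finset.subset_insert i s), h3, ?_⟩
      rw [Finset.insert_sdiff_of_notMem _ fun h => hi (hts h),
        Finset.prod_insert fun h => hi (Finset.mem_sdiff.mp h).1, h1, h4]

theorem IsIndec.prod_erase [DecidableEq (Quotient isoSetoid.{u})] (hc : IsIndec c) (hc1 : c ≠ 1)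
    (t : Multiset (Quotient isoSetoid.{u})) (ht : ∀ d ∈ t, IsIndec d ∧ d ≠ 1)
    (h : c * x = t.prod) : c ∈ t ∧ x = (t.erase c).prod := by
  induction t using Multiset.induction generalizing x with
  | empty => exact absurd (eq_one_of_mul_eq_one h) hc1
  | cons d t ih =>
    have hd := ht d (Multiset.mem_cons_self d t)
    rw [Multiset.prod_cons] at h
    rcases hc.exchange h with ⟨w, h1, h2⟩ | ⟨w, h1, h2⟩
    · obtain rfl := hd.1.eq_of_eq_mul hc1 h1
      rw [Multiset.erase_cons_head]
      exact ⟨Multiset.mem_cons_self d t, hd.1.mul_left_cancel h⟩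
    · obtain ⟨h3, h4⟩ := ih (fun e he => ht e (Multiset.mem_cons_of_mem he)) h1.symm
      refine ⟨Multiset.mem_cons_of_mem h3, ?_⟩
      by_cases hcd : d = c
      · subst hcd
        rw [Multiset.erase_cons_head, h2, h4, mul_comm, ← Multiset.prod_cons,
          Multiset.cons_erase h3]
      · rw [Multiset.erase_cons_tail _ hcd, Multiset.prod_cons, ← h4, h2, mul_comm]

/-- The Krull–Schmidt theorem for complex Lie algebras. -/
theorem multiset_eq_of_prod_eq (s t : Multiset (Quotient isoSetoid.{u}))
    (hs : ∀ d ∈ s, IsIndec d ∧ d ≠ 1) (ht : ∀ d ∈ t, IsIndec d ∧ d ≠ 1)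
    (h : s.prod = t.prod) : s = t := by
  classical
  induction s using Multiset.induction generalizing t with
  | empty =>
    refine (Multiset.eq_zero_of_forall_notMem fun d hd => (ht d hd).2 ?_).symm
    rw [Multiset.prod_zero, ← Multiset.cons_erase hd, Multiset.prod_cons] at h
    exact eq_one_of_mul_eq_one h.symm
  | cons c s ih =>
    have hc := hs c (Multiset.mem_cons_self c s)
    rw [Multiset.prod_cons] at h
    obtain ⟨h1, h2⟩ := hc.1.prod_erase hc.2 t ht h
    rw [ih (t.erase c) (fun d hd => hs d (Multiset.mem_cons_of_mem hd))
      (fun d hd => ht d (Multiset.mem_of_mem_erase hd)) h2, Multiset.cons_erase h1]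

end Indec

/-! ### From internal direct sums to products of classes -/

section Ideals

variable {G : Type u} [LieRing G] [LieAlgebra ℂ G]

theorem cls_sup {I J : LieIdeal ℂ G} (h : Disjoint I J) :
    cls (I ⊔ J : LieIdeal ℂ G) = cls I * cls J :=
  (cls_eq_cls_iff.mpr (LieAlgebra.nonempty_prod_equiv_sup h)).symm

theorem cls_top : cls (⊤ : LieIdeal ℂ G) = cls G :=
  cls_eq_cls_iff.mpr ⟨LieSubalgebra.topEquiv⟩

theorem cls_eq_mul {I J : LieIdeal ℂ G} (h : IsCompl I J) : cls G = cls I * cls J := by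
  rw [← cls_sup h.disjoint, h.sup_eq_top, cls_top]

theorem cls_eq_prod {ι : Type*} [Fintype ι] [DecidableEq ι] (I : ι → LieIdeal ℂ G)
    (h : DirectSum.IsInternal I) : cls G = ∏ i, cls (I i) := by
  have h' : DirectSum.IsInternal fun i => (I i).toSubmodule := h
  rw [DirectSum.isInternal_submodule_iff_iSupIndep_and_iSup_eq_top] at h'
  have hind : iSupIndep I := LieSubmodule.iSupIndep_toSubmodule.mp h'.1
  have htop : ⨆ i, I i = ⊤ := LieSubmodule.iSup_toSubmodule_eq_top.mp h'.2
  have key : ∀ s : Finset ι, cls (s.sup I : LieIdeal ℂ G) = ∏ i ∈ s, cls (I i) := by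
    intro s
    induction s using Finset.induction_on with
    | empty =>
      rw [Finset.prod_empty, cls_eq_one_iff, Finset.sup_empty]
      infer_instance
    | insert i s hi ih =>
      have hd : Disjoint (I i) (s.sup I) := by
        refine (hind i).mono_right (Finset.sup_le fun j hj => ?_)
        exact le_iSup₂_of_le j (fun h => hi (h ▸ hj)) le_rfl
      rw [Finset.prod_insert hi, ← ih, ← cls_sup hd, Finset.sup_insert]
  rw [← key, Finset.sup_univ_eq_iSup, htop, cls_top]

end Ideals

end ComplexLieAlgebra

/-! ### Trimming an ideal modulo central elements -/

namespace LieAlgebra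

variable {K L : Type*} [Field K] [LieRing L] [LieAlgebra K L]

/-- If `A / D` is central in `L / D`, then a complement of `D ⊔ Z` in `A` generates together with
`D` an ideal. -/
theorem exists_ideal_inf_le_and_sup_eq (D A Z : LieIdeal K L) (hDA : D ≤ A) (hZA : Z ≤ A)
    (hAD : ∀ x ∈ A, ∀ y : L, ⁅x, y⁆ ∈ D) :
    ∃ J : LieIdeal K L, D ≤ J ∧ J ≤ A ∧ J ⊓ Z ≤ D ∧ J ⊔ Z = A := by
  -- A vector space complement suffices: every subspace between `D` and `A` is an ideal, because
  -- brackets with `A` fall into `D`.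
  obtain ⟨V, hV, hVA⟩ := IsModularLattice.exists_disjoint_and_sup_eq
    (show (D ⊔ Z).toSubmodule ≤ A.toSubmodule from sup_le hDA hZA)
  have hJA : D.toSubmodule ⊔ V ≤ A.toSubmodule := sup_le hDA (le_sup_right.trans hVA.le)
  let J : LieIdeal K L :=
    { D.toSubmodule ⊔ V with
      lie_mem := fun {x m} hm => by
        have h : ⁅x, m⁆ ∈ D.toSubmodule := by
          rw [← lie_skew]
          exact neg_mem (hAD m (hJA hm) x)
        exact (le_sup_left : D.toSubmodule ≤ D.toSubmodule ⊔ V) h }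
  have hJ : J.toSubmodule = D.toSubmodule ⊔ V := rfl
  refine ⟨J, ?_, hJA, ?_, ?_⟩
  · exact (le_sup_left : D.toSubmodule ≤ D.toSubmodule ⊔ V)
  · rintro x ⟨hxJ, hxZ⟩
    obtain ⟨y, hy, v, hv, rfl⟩ := Submodule.mem_sup.mp (show x ∈ D.toSubmodule ⊔ V from hxJ)
    have h1 : v ∈ (D ⊔ Z).toSubmodule := by
      have h2 : y + v - y ∈ D ⊔ Z := sub_mem
        ((le_sup_right : Z ≤ D ⊔ Z) hxZ) ((le_sup_left : D ≤ D ⊔ Z) hy)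
      rwa [add_sub_cancel_left] at h2
    rw [Submodule.disjoint_def.mp hV v h1 hv, add_zero]
    exact hy
  · rw [← LieSubmodule.toSubmodule_inj, LieSubmodule.sup_toSubmodule, hJ, ← hVA,
      LieSubmodule.sup_toSubmodule, sup_right_comm]

end LieAlgebra

/-! ### Linear and conjugate-linear parts of a real isomorphism -/

/-- An isomorphism between the real Lie algebras underlying two complex Lie algebras. -/
structure RealLieEquiv (G H : Type*) [LieRing G] [LieAlgebra ℂ G] [LieRing H] [LieAlgebra ℂ H]
    extends G ≃+ H where
  map_real_smul' : ∀ (r : ℝ) (x : G), toFun ((r : ℂ) • x) = (r : ℂ) • toFun x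
  map_lie' : ∀ x y : G, toFun ⁅x, y⁆ = ⁅toFun x, toFun y⁆

namespace RealLieEquiv

open Module
open Complex (I)

variable {G H : Type*} [LieRing G] [LieAlgebra ℂ G] [LieRing H] [LieAlgebra ℂ H]

theorem finrank_eq (d : G ≃+ H) (hd : ∀ (r : ℝ) (x : G), d ((r : ℂ) • x) = (r : ℂ) • d x) :
    finrank ℂ G = finrank ℂ H := by
  let e : G ≃ₗ[ℝ] H := { d with map_smul' := hd }
  have h := e.finrank_eq
  rw [finrank_real_of_complex, finrank_real_of_complex] at h
  omega

variable (d : RealLieEquiv G H)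

instance : EquivLike (RealLieEquiv G H) G H where
  coe d := d.toFun
  inv d := d.invFun
  left_inv d := d.left_inv
  right_inv d := d.right_inv
  coe_injective' := by
    rintro ⟨⟨⟨f, g, _, _⟩, _⟩, _, _⟩ ⟨⟨⟨f', g', _, _⟩, _⟩, _, _⟩ h h'
    cases h
    cases h'
    rfl

instance : AddEquivClass (RealLieEquiv G H) G H where
  map_add d := d.map_add'

theorem map_real_smul (r : ℝ) (x : G) : d ((r : ℂ) • x) = (r : ℂ) • d x := d.map_real_smul' r x

theorem map_lie (x y : G) : d ⁅x, y⁆ = ⁅d x, d y⁆ := d.map_lie' x y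

/-- The inverse isomorphism. -/
def symm : RealLieEquiv H G where
  __ := d.toAddEquiv.symm
  map_real_smul' r x := d.injective (by
    have h : ∀ y, d (d.toAddEquiv.symm y) = y := d.toAddEquiv.apply_symm_apply
    exact (h _).trans ((congrArg _ (h x).symm).trans (d.map_real_smul _ _).symm))
  map_lie' x y := d.injective (by
    have h : ∀ y, d (d.toAddEquiv.symm y) = y := d.toAddEquiv.apply_symm_apply
    exact (h _).trans ((congrArg₂ _ (h x).symm (h y).symm).trans (d.map_lie _ _).symm))

@[simp]
theorem apply_symm_apply (x : H) : d (d.symm x) = x := d.toAddEquiv.apply_symm_apply x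

@[simp]
theorem symm_apply_apply (x : G) : d.symm (d x) = x := d.toAddEquiv.symm_apply_apply x

theorem finrank_ideal_eq {P : LieIdeal ℂ G} {Q : LieIdeal ℂ H} (h : ∀ x ∈ P, d x ∈ Q)
    (h' : ∀ x ∈ Q, d.symm x ∈ P) : finrank ℂ P = finrank ℂ Q :=
  finrank_eq
    { toFun := fun x => ⟨d x, h x x.2⟩
      invFun := fun x => ⟨d.symm x, h' x x.2⟩
      left_inv := fun x => Subtype.ext (d.symm_apply_apply x)
      right_inv := fun x => Subtype.ext (d.apply_symm_apply x)
      map_add' := fun _ _ => Subtype.ext (map_add d _ _) }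
    fun r x => Subtype.ext (d.map_real_smul r x)

theorem map_mem_derived {x : G} (hx : x ∈ ⁅(⊤ : LieIdeal ℂ G), (⊤ : LieIdeal ℂ G)⁆) :
    d x ∈ ⁅(⊤ : LieIdeal ℂ H), (⊤ : LieIdeal ℂ H)⁆ := by
  -- Since `d` is only real-linear, the span induction has to carry all complex multiples of `x`
  -- along.
  have key : ∀ z : ℂ, d (z • x) ∈ ⁅(⊤ : LieIdeal ℂ H), (⊤ : LieIdeal ℂ H)⁆ := by
    rw [← LieSubmodule.mem_toSubmodule, LieSubmodule.lieIdeal_oper_eq_linear_span'] at hx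
    induction hx using Submodule.span_induction with
    | mem x hx =>
      obtain ⟨a, -, b, -, rfl⟩ := hx
      intro z
      rw [← lie_smul, map_lie]
      exact LieSubmodule.lie_mem_lie (LieSubmodule.mem_top _) (LieSubmodule.mem_top _)
    | zero => intro z; rw [smul_zero, map_zero]; exact zero_mem _
    | add x y _ _ hx hy => intro z; rw [smul_add, map_add]; exact add_mem (hx z) (hy z)
    | smul w x _ hx => intro z; rw [smul_smul]; exact hx _
  simpa using key 1

theorem map_mem_center {x : G} (hx : x ∈ LieAlgebra.center ℂ G) :
    d x ∈ LieAlgebra.center ℂ H := by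
  rw [LieModule.mem_maxTrivSubmodule] at hx ⊢
  intro y
  rw [← d.apply_symm_apply y, ← map_lie, hx, map_zero]

/-- The elements at which `d` is linear (for `s = 1`) or conjugate-linear (for `s = -1`) in the
direction of `I`. -/
def eigenspace (s : ℝ) : AddSubgroup G where
  carrier := {x | d (I • x) = ((s : ℂ) * I) • d x}
  zero_mem' := by simp
  add_mem' {x y} hx hy := by
    simp only [Set.mem_ofPred_eq, smul_add, map_add] at *
    rw [hx, hy]
  neg_mem' {x} hx := by
    simp only [Set.mem_ofPred_eq, smul_neg, map_neg] at *
    rw [hx]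

variable {d} {s t : ℝ}

theorem mem_eigenspace {x : G} : x ∈ d.eigenspace s ↔ d (I • x) = ((s : ℂ) * I) • d x := Iff.rfl

theorem eq_zero_of_mem_eigenspace {x : G} (h : x ∈ d.eigenspace 1) (h' : x ∈ d.eigenspace (-1)) :
    x = 0 := by
  rw [mem_eigenspace] at h h'
  rw [h] at h'
  have h1 : ((2 : ℂ) * I) • d x = 0 := by
    rw [← sub_eq_zero, ← sub_smul] at h'
    rw [← h']
    congr 1
    push_cast
    ring
  have h2 : d x = 0 := (smul_eq_zero.mp h1).resolve_left (by simp)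
  exact d.injective (h2.trans (map_zero d).symm)

variable (d s)

/-- The elements `x` such that `d` is linear or conjugate-linear at all brackets `⁅x, y⁆`. -/
def part : LieIdeal ℂ G where
  carrier := {x | ∀ y, ⁅x, y⁆ ∈ d.eigenspace s}
  zero_mem' y := by rw [zero_lie]; exact zero_mem _
  add_mem' {a b} ha hb y := by rw [add_lie]; exact add_mem (ha y) (hb y)
  smul_mem' z x hx y := by rw [smul_lie, ← lie_smul]; exact hx _
  lie_mem {w x} hx y := by
    rw [lie_lie]
    refine sub_mem ?_ (hx _)
    rw [mem_eigenspace, ← lie_smul, map_lie, mem_eigenspace.mp (hx y), map_lie d w, lie_smul]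

variable {d s}

theorem center_le_part : LieAlgebra.center ℂ G ≤ d.part s := by
  intro x hx y
  rw [LieModule.mem_maxTrivSubmodule] at hx
  rw [← lie_skew, hx, neg_zero]
  exact zero_mem _

theorem lie_eq_zero_of_mem_part {x y : G} (hx : x ∈ d.part 1) (hy : y ∈ d.part (-1)) :
    ⁅x, y⁆ = 0 := by
  refine eq_zero_of_mem_eigenspace (hx y) ?_
  rw [← lie_skew]
  exact neg_mem (hy x)

theorem mem_center_of_mem_part {x : G} (hx : x ∈ d.part 1) (hx' : x ∈ d.part (-1)) :
    x ∈ LieAlgebra.center ℂ G := by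
  rw [LieModule.mem_maxTrivSubmodule]
  intro y
  rw [← lie_skew, eq_zero_of_mem_eigenspace (hx y) (hx' y), neg_zero]

/-- With `J = d.symm ∘ I ∘ d`, the operator `1 - s I J` is twice the projection onto the eigenspace
for `s` on brackets, where `I` and `J` commute. It can be pulled out of `⁅x, y⁆`, hence sends every
`x` into `d.part s`. -/
theorem half_smul_mem_part (hs : s * s = 1) (x : G) :
    x - ((s : ℂ) * I) • d.symm (I • d x) ∈ d.part s := by
  intro y
  have hs' : (s : ℂ) * s = 1 := by exact_mod_cast hs
  set r := d.symm (I • d x) with hr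
  have h1 : ∀ y, d ⁅r, y⁆ = I • d ⁅x, y⁆ := by
    intro y
    rw [map_lie, hr, apply_symm_apply, smul_lie, map_lie]
  have h2 : d ⁅x - ((s : ℂ) * I) • r, y⁆ = d ⁅x, y⁆ - ((s : ℂ) * I) • d (I • ⁅x, y⁆) := by
    rw [sub_lie, map_sub, mul_smul, smul_lie, smul_lie, map_real_smul, ← lie_smul, h1, mul_smul,
      lie_smul]
  have h3 : d (I • ⁅x - ((s : ℂ) * I) • r, y⁆) = d (I • ⁅x, y⁆) + ((s : ℂ) * I) • d ⁅x, y⁆ := by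
    have : I • ⁅x - ((s : ℂ) * I) • r, y⁆ = I • ⁅x, y⁆ + (s : ℂ) • ⁅r, y⁆ := by
      rw [sub_lie, smul_lie, smul_sub, smul_smul, sub_eq_add_neg, ← neg_smul]
      congr 2
      linear_combination (-(s : ℂ)) * Complex.I_mul_I
    rw [this, map_add, map_real_smul, h1, mul_smul]
  rw [mem_eigenspace, h3, h2, smul_sub, smul_smul, add_comm, sub_eq_add_neg, ← neg_smul]
  congr 1
  have : -((s : ℂ) * I * (s * I)) = 1 := by
    linear_combination (-(s : ℂ) * s) * Complex.I_mul_I + hs'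
  rw [this, one_smul]

/-- Every `x` is the mean of `x - I J x` and `x + I J x`. -/
theorem part_sup_part : d.part 1 ⊔ d.part (-1) = ⊤ := by
  rw [eq_top_iff]
  intro x _
  have h1 := (d.part 1).smul_mem (1 / 2 : ℂ) (half_smul_mem_part (d := d) (s := 1) (by norm_num) x)
  have h2 := (d.part (-1)).smul_mem (1 / 2 : ℂ)
    (half_smul_mem_part (d := d) (s := -1) (by norm_num) x)
  refine (LieSubmodule.mem_sup _ _ _).mpr ⟨_, h1, _, h2, ?_⟩
  rw [← smul_add]
  push_cast
  module

variable (d s)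

/-- The linear part (for `s = 1`) or the conjugate-linear part (for `s = -1`) of `d`. -/
noncomputable def component : G →+ H where
  toFun x := (1 / 2 : ℂ) • (d x - ((s : ℂ) * I) • d (I • x))
  map_zero' := by simp
  map_add' x y := by
    simp only [smul_add, map_add]
    module

variable {d s}

theorem component_apply (x : G) :
    d.component s x = (1 / 2 : ℂ) • (d x - ((s : ℂ) * I) • d (I • x)) := rfl

theorem component_smul (hs : s * s = 1) (a b : ℝ) (x : G) :
    d.component s (((a : ℂ) + b * I) • x) = ((a : ℂ) + b * (s * I)) • d.component s x := by
  have hs' : (s : ℂ) * s = 1 := by exact_mod_cast hs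
  have h1 : d (((a : ℂ) + b * I) • x) = (a : ℂ) • d x + (b : ℂ) • d (I • x) := by
    rw [add_smul, mul_smul, map_add, map_real_smul, map_real_smul]
  have h2 : d (I • ((a : ℂ) + b * I) • x) = (a : ℂ) • d (I • x) - (b : ℂ) • d x := by
    have : I • ((a : ℂ) + b * I) • x = (a : ℂ) • I • x - (b : ℂ) • x := by
      rw [smul_smul, smul_smul, ← sub_smul]
      congr 1
      linear_combination (b : ℂ) * Complex.I_mul_I
    rw [this, map_sub, map_real_smul, map_real_smul]
  rw [component_apply, component_apply, h1, h2]
  match_scalars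
  · ring
  · linear_combination (-b / 2 : ℂ) * hs' + (b / 2 * s * s : ℂ) * Complex.I_mul_I

theorem component_of_mem_eigenspace (hs : s * s = 1) {x : G} (hx : x ∈ d.eigenspace s) :
    d.component s x = d x := by
  have hs' : (s : ℂ) * s = 1 := by exact_mod_cast hs
  rw [component_apply, mem_eigenspace.mp hx]
  match_scalars
  linear_combination (1 / 2 : ℂ) * hs' - (1 / 2 * s * s : ℂ) * Complex.I_mul_I

/-- On `⁅x, y⁆` the map `d` equals its component, and the scalars in the component can be moved to
`x`. Thus replacing `d x` by the component changes no bracket, although `d` itself need not be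
linear or conjugate-linear on `d.part s`. -/
theorem lie_component_left (hs : s * s = 1) {x : G} (hx : x ∈ d.part s) (y : G) :
    ⁅d.component s x, d y⁆ = d ⁅x, y⁆ := by
  rw [← component_of_mem_eigenspace hs (hx y), component_apply, component_apply, smul_lie, sub_lie,
    smul_lie, ← map_lie, ← map_lie, smul_lie]

theorem lie_component (hs : s * s = 1) (ht : t * t = 1) {x y : G} (hx : x ∈ d.part s)
    (hy : y ∈ d.part t) : ⁅d.component s x, d.component t y⁆ = d ⁅x, y⁆ := by
  have h := lie_component_left hs hx (d.symm (d.component t y))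
  rw [apply_symm_apply] at h
  rw [h, ← lie_skew, map_neg, map_lie, apply_symm_apply, lie_component_left ht hy, ← map_neg,
    lie_skew]

end RealLieEquiv

/-! ### A real isomorphism conjugates a direct factor -/

namespace RealLieEquiv

open Module ComplexLieAlgebra

variable {G H : Type u} [LieRing G] [LieAlgebra ℂ G] [LieRing H] [LieAlgebra ℂ H]

/-- The restriction of `d.component 1` to a subideal of `d.part 1`. -/
noncomputable def componentHom (d : RealLieEquiv G H) (J : LieIdeal ℂ G) (hJ : J ≤ d.part 1) :
    J →ₗ⁅ℂ⁆ H where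
  toFun x := d.component 1 x
  map_add' x y := map_add (d.component 1) (x : G) y
  map_smul' z x := by
    have h := component_smul (d := d) (s := 1) (by norm_num) z.re z.im (x : G)
    rw [Complex.re_add_im, Complex.ofReal_one, one_mul, Complex.re_add_im] at h
    exact h
  map_lie' {x y} := by
    have h := component_of_mem_eigenspace (d := d) (s := 1) (by norm_num) (hJ x.2 y)
    exact h.trans (lie_component (by norm_num) (by norm_num) (hJ x.2) (hJ y.2)).symm

/-- The restriction of `d.component (-1)` to a subideal of `d.part (-1)`. -/
noncomputable def conjComponentHom (d : RealLieEquiv G H) (J : LieIdeal ℂ G)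
    (hJ : J ≤ d.part (-1)) : ConjLie J →ₗ⁅ℂ⁆ H where
  toFun x := d.component (-1) (ConjLie.of.symm x : J)
  map_add' x y :=
    map_add (d.component (-1)) ((ConjLie.of.symm x : J) : G) (ConjLie.of.symm y : J)
  map_smul' z x := by
    have h := component_smul (d := d) (s := -1) (by norm_num) z.re (-z.im)
      ((ConjLie.of.symm x : J) : G)
    have h1 : ((z.re : ℂ) + ((-z.im : ℝ) : ℂ) * Complex.I) = starRingEnd ℂ z := by
      apply Complex.ext <;> simp
    have h2 : ((z.re : ℂ) + ((-z.im : ℝ) : ℂ) * (((-1 : ℝ) : ℂ) * Complex.I)) = z := by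
      apply Complex.ext <;> simp
    rw [h1, h2] at h
    exact h
  map_lie' {x y} := by
    have hx := hJ (ConjLie.of.symm x : J).2
    have hy := hJ (ConjLie.of.symm y : J).2
    have h := component_of_mem_eigenspace (d := d) (s := -1) (by norm_num)
      (hx ((ConjLie.of.symm y : J) : G))
    exact h.trans (lie_component (by norm_num) (by norm_num) hx hy).symm

theorem lie_part_le_eigenspace (d : RealLieEquiv G H) (s : ℝ) {x : G}
    (hx : x ∈ ⁅d.part s, (⊤ : LieIdeal ℂ G)⁆) : x ∈ d.eigenspace s := by
  have key : ∀ z : ℂ, z • x ∈ d.eigenspace s := by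
    rw [← LieSubmodule.mem_toSubmodule, LieSubmodule.lieIdeal_oper_eq_linear_span'] at hx
    induction hx using Submodule.span_induction with
    | mem x hx =>
      obtain ⟨a, ha, b, -, rfl⟩ := hx
      intro z
      rw [← lie_smul]
      exact ha _
    | zero => intro z; rw [smul_zero]; exact zero_mem _
    | add x y _ _ hx hy => intro z; rw [smul_add]; exact add_mem (hx z) (hy z)
    | smul w x _ hx => intro z; rw [smul_smul]; exact hx _
  simpa using key 1

/-- If two complex Lie algebras have isomorphic underlying real Lie algebras, then the second
one arises from the first one by conjugating a direct factor. -/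
theorem exists_cls_eq_mul_conj [FiniteDimensional ℂ G] (d : RealLieEquiv G H) :
    ∃ a b, cls G = a * b ∧ cls H = a * conj b := by
  let Z := LieAlgebra.center ℂ G
  let D : LieIdeal ℂ G := ⁅(⊤ : LieIdeal ℂ G), (⊤ : LieIdeal ℂ G)⁆
  let Z' := LieAlgebra.center ℂ H
  let D' : LieIdeal ℂ H := ⁅(⊤ : LieIdeal ℂ H), (⊤ : LieIdeal ℂ H)⁆
  let P : ℝ → LieIdeal ℂ G := fun s => d.part s
  let E : ℝ → LieIdeal ℂ G := fun s => ⁅P s, (⊤ : LieIdeal ℂ G)⁆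
  have hZlie : ∀ x ∈ Z, ∀ y : G, ⁅x, y⁆ = 0 := fun x hx y => by
    rw [← lie_skew, (LieModule.mem_maxTrivSubmodule (R := ℂ) (L := G) (M := G) x).mp hx, neg_zero]
  have hZlie' : ∀ x ∈ Z', ∀ y : H, ⁅x, y⁆ = 0 := fun x hx y => by
    rw [← lie_skew, (LieModule.mem_maxTrivSubmodule (R := ℂ) (L := H) (M := H) x).mp hx, neg_zero]
  have : FiniteDimensional ℂ H := by
    have e : G ≃ₗ[ℝ] H := { d.toAddEquiv with map_smul' := d.map_real_smul }
    have : FiniteDimensional ℝ H := e.finiteDimensional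
    exact FiniteDimensional.right ℝ ℂ H
  -- `W` and `W'` are the central summands lying outside the derived algebras: complements of `D ⊓
  -- Z` in `Z` and of `D' ⊓ Z'` in `Z'`.
  obtain ⟨W, -, hWZ, hWD, hWsup⟩ := LieAlgebra.exists_ideal_inf_le_and_sup_eq ⊥ Z (D ⊓ Z) bot_le
    inf_le_right fun x hx y => by rw [hZlie x hx]; exact zero_mem _
  obtain ⟨W', -, hWZ', hWD', hWsup'⟩ := LieAlgebra.exists_ideal_inf_le_and_sup_eq ⊥ Z' (D' ⊓ Z')
    bot_le inf_le_right fun x hx y => by rw [hZlie' x hx]; exact zero_mem _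
  have hex : ∀ s, ∃ J : LieIdeal ℂ G, E s ≤ J ∧ J ≤ P s ∧ J ⊓ Z ≤ E s ∧ J ⊔ Z = P s := fun s =>
    LieAlgebra.exists_ideal_inf_le_and_sup_eq (E s) (P s) Z (LieSubmodule.lie_le_left _ _)
      center_le_part fun x hx y => LieSubmodule.lie_mem_lie hx (LieSubmodule.mem_top y)
  obtain ⟨A, hEA, hAP, hAZ, hAsup⟩ := hex 1
  obtain ⟨B, hEB, hBP, hBZ, hBsup⟩ := hex (-1)
  have hED : E 1 ⊔ E (-1) = D := by
    rw [← LieSubmodule.sup_lie, show P 1 ⊔ P (-1) = ⊤ from part_sup_part]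
  have hE0 : ∀ x ∈ E 1, x ∈ E (-1) → x = 0 := fun x hx hx' =>
    eq_zero_of_mem_eigenspace (lie_part_le_eigenspace d 1 hx) (lie_part_le_eigenspace d (-1) hx')
  -- As the difference of `x + y` and `y`, the element `x` also lies in `P (-1)`, so it is central,
  -- and the central elements of `A` lie in `E 1`. This one fact gives both the directness of the
  -- sum and the injectivity of `F`.
  have hcent : ∀ x ∈ A, ∀ y ∈ B, x + y ∈ Z → x ∈ E 1 ∧ y ∈ E (-1) := by
    intro x hx y hy hxy
    have hx' : x ∈ Z := mem_center_of_mem_part (d := d) (hAP hx) (by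
      have := sub_mem (center_le_part (d := d) (s := -1) hxy) (hBP hy)
      rwa [add_sub_cancel_right] at this)
    have hy' : y ∈ Z := by
      have := sub_mem hxy hx'
      rwa [add_sub_cancel_left] at this
    exact ⟨hAZ ⟨hx, hx'⟩, hBZ ⟨hy, hy'⟩⟩
  have hWD0 : ∀ x ∈ W, x ∈ D → x = 0 := fun x hx hx' =>
    (LieSubmodule.mem_bot x).mp (hWD ⟨hx, hx', hWZ hx⟩)
  have hWD0' : ∀ x ∈ W', x ∈ D' → x = 0 := fun x hx hx' =>
    (LieSubmodule.mem_bot x).mp (hWD' ⟨hx, hx', hWZ' hx⟩)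
  have hAB : Disjoint A B := by
    rw [disjoint_iff, eq_bot_iff]
    rintro x ⟨hx, hx'⟩
    have h := hcent x hx (-x) (neg_mem hx') (by rw [add_neg_cancel]; exact zero_mem _)
    exact hE0 x h.1 (by simpa using neg_mem h.2)
  have hABW : Disjoint (A ⊔ B) W := by
    rw [disjoint_iff, eq_bot_iff]
    rintro w ⟨hw, hw'⟩
    obtain ⟨x, hx, y, hy, rfl⟩ := (LieSubmodule.mem_sup _ _ _).mp hw
    have h := hcent x hx y hy (hWZ hw')
    exact hWD0 _ hw' (hED ▸ (LieSubmodule.mem_sup _ _ _).mpr ⟨x, h.1, y, h.2, rfl⟩)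
  have htop : A ⊔ B ⊔ W = ⊤ := by
    have hD : D ≤ A ⊔ B ⊔ W := by
      rw [← hED]
      exact (sup_le_sup hEA hEB).trans le_sup_left
    have hZ : Z ≤ A ⊔ B ⊔ W := by
      rw [← hWsup]
      exact sup_le le_sup_right (inf_le_left.trans hD)
    rw [eq_top_iff, ← part_sup_part (d := d)]
    refine sup_le ?_ ?_
    · rw [← show A ⊔ Z = d.part 1 from hAsup]
      exact sup_le (le_sup_left.trans le_sup_left) hZ
    · rw [← show B ⊔ Z = d.part (-1) from hBsup]
      exact sup_le (le_sup_right.trans le_sup_left) hZ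
  have hG : cls G = cls A * cls W * cls B := by
    rw [cls_eq_mul ⟨hABW, codisjoint_iff.mpr htop⟩, cls_sup hAB, mul_right_comm]
  refine ⟨cls A * cls W, cls B, hG, ?_⟩
  -- `d` need not map `W` to `W'`, but it preserves the centre and its intersection with the derived
  -- algebra, so dimensions agree. Any linear isomorphism then serves, both ideals being central.
  have hWdim : finrank ℂ W = finrank ℂ W' := by
    have h1 : finrank ℂ Z = finrank ℂ Z' := d.finrank_ideal_eq
      (fun x hx => d.map_mem_center hx) fun x hx => d.symm.map_mem_center hx
    have h2 : finrank ℂ (D ⊓ Z : LieIdeal ℂ G) = finrank ℂ (D' ⊓ Z' : LieIdeal ℂ H) :=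
      d.finrank_ideal_eq
        (fun x hx => ⟨d.map_mem_derived hx.1, d.map_mem_center hx.2⟩)
        fun x hx => ⟨d.symm.map_mem_derived hx.1, d.symm.map_mem_center hx.2⟩
    have h3 : finrank ℂ Z = finrank ℂ W + finrank ℂ (D ⊓ Z : LieIdeal ℂ G) := by
      have := Submodule.finrank_sup_add_finrank_inf_eq W.toSubmodule (D ⊓ Z).toSubmodule
      rw [← LieSubmodule.sup_toSubmodule, ← LieSubmodule.inf_toSubmodule, hWsup,
        eq_bot_iff.mpr hWD, LieSubmodule.bot_toSubmodule, finrank_bot, add_zero] at this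
      exact this
    have h4 : finrank ℂ Z' = finrank ℂ W' + finrank ℂ (D' ⊓ Z' : LieIdeal ℂ H) := by
      have := Submodule.finrank_sup_add_finrank_inf_eq W'.toSubmodule (D' ⊓ Z').toSubmodule
      rw [← LieSubmodule.sup_toSubmodule, ← LieSubmodule.inf_toSubmodule, hWsup',
        eq_bot_iff.mpr hWD', LieSubmodule.bot_toSubmodule, finrank_bot, add_zero] at this
      exact this
    omega
  let θ : W ≃ₗ[ℂ] W' := LinearEquiv.ofFinrankEq _ _ hWdim
  let g : W →ₗ⁅ℂ⁆ H :=
    { W'.toSubmodule.subtype ∘ₗ θ.toLinearMap with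
      map_lie' := fun {x y} => by
        have h1 : ⁅x, y⁆ = 0 := Subtype.ext (hZlie _ (hWZ x.2) (y : G))
        change ((θ ⁅x, y⁆ : W') : H) = ⁅((θ x : W') : H), ((θ y : W') : H)⁆
        rw [h1, map_zero, hZlie' _ (hWZ' (θ x).2)]
        rfl }
  have hg : ∀ w, g w = (θ w : H) := fun _ => rfl
  have hglie : ∀ (w : W) (y : H), ⁅g w, y⁆ = 0 := fun w y => hZlie' _ (hWZ' (θ w).2) y
  let f₁ := d.componentHom A hAP
  let f₂ := d.conjComponentHom B hBP
  have hf₁ : ∀ x : A, f₁ x = d.component 1 (x : G) := fun _ => rfl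
  have hf₂ : ∀ y : ConjLie B, f₂ y = d.component (-1) ((ConjLie.of.symm y : B) : G) := fun _ => rfl
  let F : (A × W) × ConjLie B →ₗ⁅ℂ⁆ H := LieAlgebra.coprodHom
    (LieAlgebra.coprodHom f₁ g fun x w => by rw [← lie_skew, hglie, neg_zero]) f₂ (by
      rintro ⟨x, w⟩ y
      have hx := hAP x.2
      have hy := hBP (ConjLie.of.symm y : B).2
      rw [LieAlgebra.coprodHom_apply, add_lie, hglie, add_zero, hf₁, hf₂,
        lie_component (by norm_num) (by norm_num) hx hy, lie_eq_zero_of_mem_part hx hy, map_zero])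
  have hinj : Function.Injective F := by
    rw [injective_iff_map_eq_zero]
    rintro ⟨⟨x, w⟩, y'⟩ h
    obtain ⟨y, rfl⟩ := ConjLie.of.surjective y'
    have h : d.component 1 (x : G) + g w + d.component (-1) (y : G) = 0 := h
    -- Bracketing the relation `h` with `d z` removes `g w` and turns the components back into `d`.
    have hxy : (x : G) + y ∈ Z := by
      rw [LieModule.mem_maxTrivSubmodule]
      intro z
      have h1 : ⁅d.component 1 (x : G) + g w + d.component (-1) (y : G), d z⁆ = 0 := by
        rw [h, zero_lie]
      rw [add_lie, add_lie, hglie, add_zero, lie_component_left (by norm_num) (hAP x.2),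
        lie_component_left (by norm_num) (hBP y.2), ← map_add, ← add_lie] at h1
      rw [← lie_skew, d.injective (h1.trans (map_zero d).symm), neg_zero]
    obtain ⟨hx, hy⟩ := hcent x x.2 y y.2 hxy
    rw [component_of_mem_eigenspace (by norm_num) (lie_part_le_eigenspace d 1 hx),
      component_of_mem_eigenspace (by norm_num) (lie_part_le_eigenspace d (-1) hy),
      add_right_comm, ← map_add] at h
    have hD : (x : G) + y ∈ D := hED ▸ (LieSubmodule.mem_sup _ _ _).mpr ⟨x, hx, y, hy, rfl⟩
    -- On `E 1` and `E (-1)` the components are `d`, so `g w = -d (x + y)` lies in the derived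
    -- algebra, which `W'` meets trivially.
    have hgw : g w = 0 := hWD0' _ (θ w).2 (by
      rw [eq_neg_of_add_eq_zero_right h]
      exact neg_mem (d.map_mem_derived hD))
    have hw : w = 0 := θ.injective ((Subtype.ext hgw).trans (map_zero θ).symm)
    rw [hgw, add_zero] at h
    have hxy0 : (x : G) + y = 0 := d.injective (h.trans (map_zero d).symm)
    have hx0 : (x : G) = 0 := hE0 _ hx (by
      rw [eq_neg_of_add_eq_zero_left hxy0]
      exact neg_mem hy)
    have hy0 : (y : G) = 0 := by simpa [hx0] using hxy0
    have hx0' : x = 0 := Subtype.ext hx0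
    have hy0' : y = 0 := Subtype.ext hy0
    rw [hx0', hy0', hw, map_zero]
    rfl
  have hdim : finrank ℂ ((A × W) × ConjLie B) = finrank ℂ H := by
    obtain ⟨e⟩ := (cls_eq_cls_iff (L := G) (M := (A × W) × B)).mp hG
    have h1 := e.toLinearEquiv.finrank_eq
    have h2 : finrank ℂ G = finrank ℂ H := finrank_eq d.toAddEquiv d.map_real_smul
    have h3 : finrank ℂ B = finrank ℂ (ConjLie B) := finrank_eq ConjLie.of fun r x => by
      rw [ConjLie.smul_def, Complex.conj_ofReal, AddEquiv.symm_apply_apply]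
    rw [finrank_prod] at h1 ⊢
    omega
  refine (cls_eq_cls_iff.mpr ⟨LieEquiv.ofBijective F ⟨hinj, ?_⟩⟩).symm
  exact (LinearMap.injective_iff_surjective_of_finrank_eq_finrank hdim
    (f := (F : (A × W) × ConjLie B →ₗ[ℂ] H))).mp hinj

end RealLieEquiv

/-! ### Classes with the same real form, and their number -/

namespace ComplexLieAlgebra

theorem mem_classesWithSameReal_iff {G : Type u} [LieRing G] [LieAlgebra ℂ G]
    [FiniteDimensional ℂ G] (c : Quotient isoSetoid.{u}) :
    c ∈ classesWithSameReal G ↔ ∃ a b, cls G = a * b ∧ c = a * conj b := by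
  constructor
  · rintro ⟨⟨H⟩, rfl, ⟨e⟩⟩
    let d : RealLieEquiv G H :=
      { e.symm.toLinearEquiv.toAddEquiv with
        map_real_smul' := fun r x => e.symm.toLinearEquiv.map_smul r x
        map_lie' := fun x y => e.symm.map_lie x y }
    exact d.exists_cls_eq_mul_conj
  · rintro ⟨a, b, h, rfl⟩
    obtain ⟨⟨A⟩, rfl⟩ := exists_eq_cls a
    obtain ⟨⟨B⟩, rfl⟩ := exists_eq_cls b
    obtain ⟨φ⟩ := (cls_eq_cls_iff (L := G) (M := A × B)).mp h
    refine ⟨⟨A × ConjLie B⟩, rfl, ⟨?_⟩⟩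
    let e : (A × ConjLie B) ≃+ G :=
      ((AddEquiv.refl A).prodCongr ConjLie.of.symm).trans φ.symm.toLinearEquiv.toAddEquiv
    have he : ∀ x, e x = φ.symm (x.1, ConjLie.of.symm x.2) := fun _ => rfl
    have hsmul : ∀ (r : ℝ) x, e ((r : ℂ) • x) = (r : ℂ) • e x := by
      intro r x
      rw [he, he, ← map_smul]
      congr 1
      refine Prod.ext rfl ?_
      change ConjLie.of.symm ((r : ℂ) • x.2) = (r : ℂ) • ConjLie.of.symm x.2
      rw [ConjLie.smul_def, Complex.conj_ofReal, AddEquiv.symm_apply_apply]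
    have hlie : ∀ x y, e ⁅x, y⁆ = ⁅e x, e y⁆ := fun x y => φ.symm.map_lie _ _
    exact { e with map_smul' := hsmul, map_lie' := hlie _ _ }

section Counting

open Finset

variable {l₀ r : ℕ} {k : Fin (l₀ + r) → ℕ} (c : Fin (l₀ + r) → Quotient isoSetoid.{u})

/-- The product of `k i` factors `c i` or `conj (c i)` for all `i`, where `n i` is the number
of conjugated factors for `i < l₀`. -/
def mixedProduct (n : (i : Fin l₀) → Fin (k (Fin.castAdd r i) + 1)) : Quotient isoSetoid.{u} :=
  (∏ i, conj (c (Fin.castAdd r i)) ^ (n i : ℕ) *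
    c (Fin.castAdd r i) ^ (k (Fin.castAdd r i) - n i)) *
    ∏ i, c (Fin.natAdd l₀ i) ^ k (Fin.natAdd l₀ i)

open Classical in
theorem prod_eq_mixedProduct (hself : ∀ i, conj (c (Fin.natAdd l₀ i)) = c (Fin.natAdd l₀ i))
    (τ : (i : Fin (l₀ + r)) → Fin (k i) → Quotient isoSetoid.{u})
    (hτ : ∀ i j, τ i j = c i ∨ τ i j = conj (c i))
    (n : (i : Fin l₀) → Fin (k (Fin.castAdd r i) + 1))
    (hn : ∀ i, #{j | τ (Fin.castAdd r i) j = conj (c (Fin.castAdd r i))} = n i) :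
    ∏ p : (i : Fin (l₀ + r)) × Fin (k i), τ p.1 p.2 = mixedProduct c n := by
  rw [Fintype.prod_sigma, Fin.prod_univ_add, mixedProduct]
  congr 1
  · refine Finset.prod_congr rfl fun i _ => ?_
    have h : ∀ j, τ (Fin.castAdd r i) j =
        if τ (Fin.castAdd r i) j = conj (c (Fin.castAdd r i)) then
          conj (c (Fin.castAdd r i)) else c (Fin.castAdd r i) := by
      intro j
      split_ifs with h
      · exact h
      · exact (hτ _ j).resolve_right h
    have hcard := Finset.card_filter_add_card_filter_not
      (s := (univ : Finset (Fin (k (Fin.castAdd r i)))))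
      fun j => τ (Fin.castAdd r i) j = conj (c (Fin.castAdd r i))
    rw [hn, card_univ, Fintype.card_fin] at hcard
    rw [Finset.prod_congr rfl fun j _ => h j, Finset.prod_ite, prod_const, prod_const, hn,
      ← Nat.eq_sub_of_add_eq' hcard]
  · refine Finset.prod_congr rfl fun i _ => ?_
    rw [Finset.prod_congr rfl fun j _ => (hτ (Fin.natAdd l₀ i) j).elim id
      fun h => h.trans (hself i), prod_const, card_univ, Fintype.card_fin]

theorem setOf_mul_conj_eq_range (hc : ∀ i, IsIndec (c i))
    (hconj : ∀ i, conj (c (Fin.castAdd r i)) ≠ c (Fin.castAdd r i))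
    (hself : ∀ i, conj (c (Fin.natAdd l₀ i)) = c (Fin.natAdd l₀ i))
    (a : (i : Fin (l₀ + r)) → Fin (k i) → Quotient isoSetoid.{u})
    (ha : ∀ i j, a i j = c i ∨ a i j = conj (c i)) :
    {x | ∃ y z, ∏ p : (i : Fin (l₀ + r)) × Fin (k i), a p.1 p.2 = y * z ∧ x = y * conj z} =
      Set.range (mixedProduct (k := k) c) := by
  classical
  ext x
  constructor
  · rintro ⟨y, z, h, rfl⟩
    obtain ⟨t, -, rfl, rfl⟩ := exists_split univ (fun p : (i : Fin (l₀ + r)) × Fin (k i) =>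
      a p.1 p.2) (fun p _ => (ha p.1 p.2).elim (fun h => h ▸ hc p.1) fun h => h ▸ (hc p.1).conj) h
    let τ : (i : Fin (l₀ + r)) → Fin (k i) → Quotient isoSetoid.{u} := fun i j =>
      if (⟨i, j⟩ : (i : Fin (l₀ + r)) × Fin (k i)) ∈ t then a i j else conj (a i j)
    have hτ : ∀ i j, τ i j = c i ∨ τ i j = conj (c i) := by
      intro i j
      simp only [τ]
      split_ifs
      · exact ha i j
      · rcases ha i j with h | h
        · exact Or.inr (by rw [h])
        · exact Or.inl (by rw [h, conj_conj])
    refine ⟨fun i => ⟨#{j | τ (Fin.castAdd r i) j = conj (c (Fin.castAdd r i))},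
      Nat.lt_succ_of_le ((card_le_univ _).trans_eq (Fintype.card_fin _))⟩, ?_⟩
    rw [← prod_eq_mixedProduct c hself τ hτ _ fun i => rfl, map_prod, ← prod_sdiff (subset_univ t),
      mul_comm]
    congr 1
    · exact Finset.prod_congr rfl fun p hp => if_pos hp
    · exact Finset.prod_congr rfl fun p hp => if_neg (mem_sdiff.mp hp).2
  · rintro ⟨n, rfl⟩
    let τ : (i : Fin (l₀ + r)) → Fin (k i) → Quotient isoSetoid.{u} := Fin.addCases
      (fun i j => if (j : ℕ) < n i then conj (c (Fin.castAdd r i)) else c (Fin.castAdd r i))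
      (fun i _ => c (Fin.natAdd l₀ i))
    have hτl : ∀ i j, τ (Fin.castAdd r i) j = if (j : ℕ) < n i then conj (c (Fin.castAdd r i))
        else c (Fin.castAdd r i) := fun i j => by simp only [τ, Fin.addCases_left]
    have hτr : ∀ i j, τ (Fin.natAdd l₀ i) j = c (Fin.natAdd l₀ i) := fun i j => by
      simp only [τ, Fin.addCases_right]
    have hτ : ∀ i j, τ i j = c i ∨ τ i j = conj (c i) := by
      intro i
      refine Fin.addCases (fun i j => ?_) (fun i j => ?_) i
      · rw [hτl]
        split_ifs
        · exact Or.inr rfl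
        · exact Or.inl rfl
      · exact Or.inl (hτr i j)
    have hn : ∀ i, #{j | τ (Fin.castAdd r i) j = conj (c (Fin.castAdd r i))} = n i := by
      intro i
      have h : ∀ j, τ (Fin.castAdd r i) j = conj (c (Fin.castAdd r i)) ↔ (j : ℕ) < n i := by
        intro j
        rw [hτl]
        split_ifs with h
        · simpa using h
        · simpa [h] using (hconj i).symm
      simp only [h]
      rw [Fin.card_filter_val_lt]
      exact min_eq_right (Nat.lt_succ_iff.mp (n i).2)
    -- The given factors and the desired ones agree on `s` and are conjugate to each other off `s`,
    -- so exactly the factors off `s` must be conjugated.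
    let s : Finset ((i : Fin (l₀ + r)) × Fin (k i)) := {p | a p.1 p.2 = τ p.1 p.2}
    refine ⟨∏ p ∈ s, a p.1 p.2, ∏ p ∈ univ \ s, a p.1 p.2, ?_, ?_⟩
    · rw [mul_comm, prod_sdiff (subset_univ s)]
    · rw [← prod_eq_mixedProduct c hself τ hτ n hn, map_prod, ← prod_sdiff (subset_univ s),
        mul_comm]
      congr 1
      · exact Finset.prod_congr rfl fun p hp => (mem_filter.mp hp).2.symm
      · refine Finset.prod_congr rfl fun p hp => ?_
        have h : a p.1 p.2 ≠ τ p.1 p.2 := fun h =>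
          (mem_sdiff.mp hp).2 (mem_filter.mpr ⟨mem_univ p, h⟩)
        rcases ha p.1 p.2 with h1 | h1 <;> rcases hτ p.1 p.2 with h2 | h2
        · exact absurd (h1.trans h2.symm) h
        · rw [h1, h2]
        · rw [h1, h2, conj_conj]
        · exact absurd (h1.trans h2.symm) h

/-- After cancelling the self-conjugate blocks, unique factorization recovers `n i` as the
multiplicity of `conj (c i)`, which differs from `c i` and from all factors of other blocks. -/
theorem mixedProduct_injective (hc : ∀ i, IsIndec (c i))
    (hconj : ∀ i, conj (c (Fin.castAdd r i)) ≠ c (Fin.castAdd r i))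
    (hdiff : ∀ i i', c i = c i' ∨ c i = conj (c i') → i = i') :
    Function.Injective (mixedProduct (k := k) c) := by
  classical
  intro n n' h
  -- The self-conjugate blocks are cancelled rather than counted because one of them may consist of
  -- zero algebras, to which unique factorization does not apply. The other blocks are nonzero,
  -- since `1` is self-conjugate.
  have hcancel : ∀ (t : Finset (Fin r)) (x y : Quotient isoSetoid.{u}),
      x * ∏ i ∈ t, c (Fin.natAdd l₀ i) ^ k (Fin.natAdd l₀ i) =
        y * ∏ i ∈ t, c (Fin.natAdd l₀ i) ^ k (Fin.natAdd l₀ i) → x = y := by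
    have hpow : ∀ (i : Fin (l₀ + r)) (m : ℕ) (x y : Quotient isoSetoid.{u}),
        c i ^ m * x = c i ^ m * y → x = y := by
      intro i m
      induction m with
      | zero => intro x y h; simpa using h
      | succ m ih =>
        intro x y h
        rw [pow_succ, mul_assoc, mul_assoc] at h
        exact (hc i).mul_left_cancel (ih _ _ h)
    intro t
    induction t using Finset.induction_on with
    | empty => intro x y h; simpa using h
    | insert i t hi ih =>
      intro x y h
      rw [prod_insert hi, mul_left_comm, mul_left_comm y] at h
      exact ih _ _ (hpow _ _ _ _ h)
  have hne : ∀ i, c (Fin.castAdd r i) ≠ 1 := fun i h => hconj i (by rw [h, map_one])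
  have hne' : ∀ i, conj (c (Fin.castAdd r i)) ≠ 1 := fun i h => hne i (by
    rw [← conj_conj (c (Fin.castAdd r i)), h, map_one])
  let s : ((i : Fin l₀) → Fin (k (Fin.castAdd r i) + 1)) → Multiset (Quotient isoSetoid.{u}) :=
    fun n => ∑ i, (Multiset.replicate (n i) (conj (c (Fin.castAdd r i))) +
      Multiset.replicate (k (Fin.castAdd r i) - n i) (c (Fin.castAdd r i)))
  have hs : ∀ n, ∀ d ∈ s n, IsIndec d ∧ d ≠ 1 := by
    intro n d hd
    obtain ⟨i, -, hi⟩ := Multiset.mem_sum.mp hd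
    rcases Multiset.mem_add.mp hi with h | h
    · rw [Multiset.eq_of_mem_replicate h]
      exact ⟨(hc _).conj, hne' i⟩
    · rw [Multiset.eq_of_mem_replicate h]
      exact ⟨hc _, hne i⟩
  have hprod : ∀ n, (s n).prod = ∏ i, conj (c (Fin.castAdd r i)) ^ (n i : ℕ) *
      c (Fin.castAdd r i) ^ (k (Fin.castAdd r i) - n i) := by
    intro n
    simp only [s, Multiset.prod_sum, Multiset.prod_add, Multiset.prod_replicate]
  have hcount : ∀ n i, (s n).count (conj (c (Fin.castAdd r i))) = n i := by
    intro n i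
    simp only [s, Multiset.count_sum', Multiset.count_add, Multiset.count_replicate]
    rw [Finset.sum_eq_single i]
    · rw [if_pos rfl, if_neg (hconj i).symm, add_zero]
    · intro j _ hj
      have hji : Fin.castAdd r j ≠ Fin.castAdd r i := fun h => hj (Fin.castAdd_injective _ _ h)
      have h1 : conj (c (Fin.castAdd r j)) ≠ conj (c (Fin.castAdd r i)) := fun h =>
        hji (hdiff _ _ (Or.inl (by rw [← conj_conj (c (Fin.castAdd r j)), h, conj_conj])))
      have h2 : c (Fin.castAdd r j) ≠ conj (c (Fin.castAdd r i)) := fun h =>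
        hji (hdiff _ _ (Or.inr h))
      rw [if_neg h1, if_neg h2, add_zero]
    · exact fun h => absurd (mem_univ i) h
  have heq : s n = s n' := multiset_eq_of_prod_eq _ _ (hs n) (hs n') (by
    rw [hprod, hprod]
    exact hcancel univ _ _ h)
  funext i
  exact Fin.ext (by rw [← hcount n i, heq, hcount])

theorem encard_classesWithSameReal {G : Type u} [LieRing G] [LieAlgebra ℂ G]
    [FiniteDimensional ℂ G] (hc : ∀ i, IsIndec (c i))
    (hconj : ∀ i, conj (c (Fin.castAdd r i)) ≠ c (Fin.castAdd r i))
    (hself : ∀ i, conj (c (Fin.natAdd l₀ i)) = c (Fin.natAdd l₀ i))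
    (hdiff : ∀ i i', c i = c i' ∨ c i = conj (c i') → i = i')
    (a : (i : Fin (l₀ + r)) → Fin (k i) → Quotient isoSetoid.{u})
    (ha : ∀ i j, a i j = c i ∨ a i j = conj (c i))
    (hG : cls G = ∏ p : (i : Fin (l₀ + r)) × Fin (k i), a p.1 p.2) :
    (classesWithSameReal G).encard = ((∏ i : Fin l₀, (k (Fin.castAdd r i) + 1) : ℕ) : ℕ∞) := by
  have hset : classesWithSameReal G = Set.range (mixedProduct (k := k) c) := by
    rw [← setOf_mul_conj_eq_range c hc hconj hself a ha, ← hG]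
    ext x
    exact mem_classesWithSameReal_iff x
  rw [hset, ← Set.image_univ, (mixedProduct_injective c hc hconj hdiff).encard_image,
    Set.encard_univ, ENat.card_eq_coe_fintype_card, Fintype.card_pi]
  simp only [Fintype.card_fin]

end Counting

end ComplexLieAlgebra

theorem mainTheorem6
    {G : Type u} [LieRing G] [LieAlgebra ℂ G] [FiniteDimensional ℂ G]
    -- `l` blocks, the `i`-th one consisting of the `k i ≥ 1` ideals `I i j` of `G`
    (l : ℕ) (k : Fin l → ℕ) (hk : ∀ i, 0 < k i)
    (I : (i : Fin l) → Fin (k i) → LieIdeal ℂ G)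
    -- `G` is the direct sum of all the ideals `I i j`, and each of them is indecomposable
    (hsum : DirectSum.IsInternal (fun p : (i : Fin l) × Fin (k i) => I p.1 p.2))
    (hindec : ∀ i j, LieAlgebra.IsIndecomposable ℂ (I i j))
    -- within a block, all ideals are isomorphic to the first one up to conjugation
    (hblock : ∀ i j,
      Nonempty (I i ⟨0, hk i⟩ ≃ₗ⁅ℂ⁆ I i j) ∨
      Nonempty (I i ⟨0, hk i⟩ ≃ₗ⁅ℂ⁆ ConjLie (I i j)))
    -- ideals in different blocks are neither isomorphic nor conjugate
    (hdiff : ∀ i i' : Fin l,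
      Nonempty (I i ⟨0, hk i⟩ ≃ₗ⁅ℂ⁆ I i' ⟨0, hk i'⟩) ∨
      Nonempty (I i ⟨0, hk i⟩ ≃ₗ⁅ℂ⁆ ConjLie (I i' ⟨0, hk i'⟩)) → i = i')
    -- exactly the first `l₀` blocks are not isomorphic to their own conjugates
    (l₀ : ℕ) (hl₀ : l₀ ≤ l)
    (hconj : ∀ i : Fin l,
      ¬ Nonempty (I i ⟨0, hk i⟩ ≃ₗ⁅ℂ⁆ ConjLie (I i ⟨0, hk i⟩)) ↔ (i : ℕ) < l₀) :
    (ComplexLieAlgebra.classesWithSameReal G).encard =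
      ((∏ i : Fin l₀, (k (Fin.castLE hl₀ i) + 1) : ℕ) : ℕ∞) := by
  obtain ⟨r, rfl⟩ := Nat.exists_eq_add_of_le hl₀
  have hconj' : ∀ i, ComplexLieAlgebra.cls (I i ⟨0, hk i⟩) ≠
      ComplexLieAlgebra.conj (ComplexLieAlgebra.cls (I i ⟨0, hk i⟩)) ↔ (i : ℕ) < l₀ := fun i => by
    rw [← hconj i, ← ComplexLieAlgebra.cls_eq_cls_iff, ← ComplexLieAlgebra.conj_cls]
  refine ComplexLieAlgebra.encard_classesWithSameReal
    (fun i => ComplexLieAlgebra.cls (I i ⟨0, hk i⟩))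
    (fun i => ComplexLieAlgebra.isIndec_cls _ (hindec i _))
    (fun i => ((hconj' _).mpr i.2).symm) (fun i => ?_)
    (fun i i' h => hdiff i i' (h.imp ComplexLieAlgebra.cls_eq_cls_iff.mp
      fun h => ComplexLieAlgebra.cls_eq_cls_iff.mp h))
    (fun i j => ComplexLieAlgebra.cls (I i j)) (fun i j => ?_)
    (ComplexLieAlgebra.cls_eq_prod _ hsum)
  · by_contra h
    have := (hconj' (Fin.natAdd l₀ i)).mp (Ne.symm h)
    rw [Fin.val_natAdd] at this
    omega
  · rcases hblock i j with h | h
    · exact Or.inl (ComplexLieAlgebra.cls_eq_cls_iff.mpr h).symm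
    · right
      rw [show ComplexLieAlgebra.cls (I i ⟨0, hk i⟩) =
        ComplexLieAlgebra.conj (ComplexLieAlgebra.cls (I i j)) from
          ComplexLieAlgebra.cls_eq_cls_iff.mpr h, ComplexLieAlgebra.conj_conj]
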